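/- Let $X$ and $Y$ be real Banach lattices such that $Y$ is a sublattice of $X$ (a linear subspace closed under the lattice operations of $X$, with the induced order) and such that $Y$, with its own norm $\|\cdot\|_Y$, is continuously embedded in $X$. Let $T\in(0,\infty]$. Assume: (a) $G$ is the generator of a $C_0$-semigroup $(S(t))_{t\ge0}$ on $X$ such that $S(t)$ leaves $Y$ invariant for every $t\in[0,\infty)$ and $t\mapsto S(t)y$ is continuous from $[0,\infty)$ to $Y$ for every $y\in Y$; (b) there exists $\eta:(0,\infty)\to(0,\infty)$ with $\eta(\delta)\to0$ as $\delta\to0^+$ such that, for all $0\le s_0<s_1$ and all $\varphi\in C([s_0,s_1],X)$, $$\int_{s_0}^{s_1}S(s_1-s)\varphi(s)\,ds\in Y,\qquad \Big\|\int_{s_0}^{s_1}S(s_1-s)\varphi(s)\,ds\Big\|_Y\le\eta(s_1-s_0)\,\|\varphi\|_{C([s_0,s_1],X)};$$ (c) $F:[0,T)\times Y\to X$ is continuous and, for every $t'\in[0,T)$ and $r>0$, there is a constant $L$ such that $\|F(t,f)-F(t,g)\|_X\le L\|f-g\|_Y$ for all $t\in[0,t']$ and all $f,g\in Y$ with $\|f\|_Y,\|g\|_Y\le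 r$; (d) the domain $\mathcal D(G)$ is a dense subspace of $Y$; (e) there exists a positive linear operator $H:Y\to X$ such that, for all $\gamma\ge0$, the operator $G-\gamma H$ generates a $C_0$-semigroup $(S_\gamma(t))_{t\ge0}$ on $X$ which is positive and leaves $Y$ invariant, i.e. $S_\gamma(t)Y\subseteq Y$ for every $t\in[0,\infty)$; (f) for every $\tau\in[0,T)$ and every $r>0$ there exists $\gamma\ge0$ such that $F(t,v)+\gamma Hv\ge0$ for all $t\in[0,\tau]$ and all $v\in Y$ with $v\ge0$ and $\|v\|_Y\le r$. Let $\mathring u\in Y$ with $\mathring u\ge0$, and let $u\in C([0,t_{\max}),Y)$, with $t_{\max}\in(0,T]$, be the maximal mild solution of $$u'(t)=Gu(t)+F(t,u(t)),\qquad u(0)=\mathring u,$$ that is, $$u(t)=S(t)\mathring u+\int_0^tS(t-s)F(s,u(s))\,ds,\qquad t\in[0,t_{\max}),$$ and $u$ has no extension satisfying the same equation that belongs to $C([0,\tilde t),Y)$ for some $\tilde t\in(t_{\max},T]$. Then $u(t)\ge0$ for all $t\in[0,t_{\max})$. -/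

import Mathlib

open Set Filter Topology

namespace SemilinearACP

noncomputable section

/-- The half-open time interval `[0, T)`, where `T` may be `∞`. -/
def timeInterval (T : EReal) : Set ℝ := {t : ℝ | 0 ≤ t ∧ (t : EReal) < T}

section Semigroups

variable {X : Type*} [NormedAddCommGroup X] [NormedSpace ℝ X]

/-- `(S t)_{t ≥ 0}` is a `C₀`-semigroup (strongly continuous semigroup) of bounded linear
operators on `X`. Only the values `S t` with `t ≥ 0` matter. -/
structure IsC0Semigroup (S : ℝ → X →L[ℝ] X) : Prop where
  map_zero : ∀ x : X, S 0 x = x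
  map_add : ∀ s t : ℝ, 0 ≤ s → 0 ≤ t → ∀ x : X, S (s + t) x = S s (S t x)
  tendsto_zero : ∀ x : X, Tendsto (fun t => S t x) (𝓝[>] 0) (𝓝 x)

/-- The (in general unbounded) operator `A` is the generator of the `C₀`-semigroup `S`: its domain
consists of all `x` for which the right derivative at `0` of `t ↦ S t x` exists in `X`,
and `A x` is this derivative. -/
def Generates (A : X →ₗ.[ℝ] X) (S : ℝ → X →L[ℝ] X) : Prop :=
  IsC0Semigroup S ∧
    ∀ x y : X, (x, y) ∈ A.graph ↔
      Tendsto (fun h : ℝ => h⁻¹ • (S h x - x)) (𝓝[>] 0) (𝓝 y)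

/-- A semigroup on an ordered space is positive if it preserves the positive cone. -/
def IsPositiveSemigroup [PartialOrder X] (S : ℝ → X →L[ℝ] X) : Prop :=
  ∀ t : ℝ, 0 ≤ t → ∀ x : X, 0 ≤ x → 0 ≤ S t x

end Semigroups

section Embedded

/-! The subspace `Y` of `X`, which carries its own norm, is represented by an injective
bounded linear map `ι : Y → X`. -/

variable {X : Type*} [NormedAddCommGroup X] [NormedSpace ℝ X]
  {Y : Type*} [NormedAddCommGroup Y] [NormedSpace ℝ Y]

/-- Every `S t`, `t ≥ 0`, maps (the image of) `Y` into itself. -/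
def LeavesInvariant (ι : Y →L[ℝ] X) (S : ℝ → X →L[ℝ] X) : Prop :=
  ∀ t : ℝ, 0 ≤ t → ∀ y : Y, S t (ι y) ∈ range ι

/-- A linear map `H : Y → X`, regarded as an operator in `X` with domain `Y`. -/
def operatorOn (ι : Y →L[ℝ] X) (hι : Function.Injective ι) (H : Y →ₗ[ℝ] X) : X →ₗ.[ℝ] X where
  domain := LinearMap.range (ι : Y →ₗ[ℝ] X)
  toFun := H ∘ₗ ((LinearEquiv.ofInjective (ι : Y →ₗ[ℝ] X) hι).symm :
    LinearMap.range (ι : Y →ₗ[ℝ] X) →ₗ[ℝ] Y)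

/-- `F : [0, T) × Y → X` satisfies a Lipschitz condition in the second argument on bounded sets,
uniformly in the first argument on compact intervals. -/
def LipschitzOnBounded (T : EReal) (F : ℝ → Y → X) : Prop :=
  ∀ t' ∈ timeInterval T, ∀ r : ℝ, 0 < r → ∃ L : ℝ, ∀ f g : Y, ‖f‖ ≤ r → ‖g‖ ≤ r →
    ∀ t ∈ Icc (0 : ℝ) t', ‖F t f - F t g‖ ≤ L * ‖f - g‖

/-- `u ∈ C([0, t₁), Y)` is a mild solution on `[0, t₁)` of
`u'(t) = G u(t) + F(t, u(t))`, `u(0) = u₀`, where `G` is the generator of `S`. -/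
def IsMildSolution (ι : Y →L[ℝ] X) (S : ℝ → X →L[ℝ] X) (F : ℝ → Y → X) (u₀ : Y)
    (t₁ : EReal) (u : ℝ → Y) : Prop :=
  ContinuousOn u (timeInterval t₁) ∧
    ∀ t ∈ timeInterval t₁,
      ι (u t) = S t (ι u₀) + ∫ s in (0 : ℝ)..t, S (t - s) (F s (u s))

/-- `u` is a mild solution on `[0, t₁)` with `t₁ ∈ (0, T]` that cannot be extended to
a mild solution on a larger interval `[0, t₂)` with `t₂ ∈ (t₁, T]`. -/
def IsMaximalMildSolution (ι : Y →L[ℝ] X) (S : ℝ → X →L[ℝ] X) (T : EReal) (F : ℝ → Y → X)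
    (u₀ : Y) (t₁ : EReal) (u : ℝ → Y) : Prop :=
  0 < t₁ ∧ t₁ ≤ T ∧ IsMildSolution ι S F u₀ t₁ u ∧
    ¬ ∃ t₂ : EReal, t₁ < t₂ ∧ t₂ ≤ T ∧
      ∃ v : ℝ → Y, IsMildSolution ι S F u₀ t₂ v ∧ EqOn v u (timeInterval t₁)

end Embedded

end

end SemilinearACP

open SemilinearACP

/-! Positivity is first proved on short intervals. Let `u` solve the equation with nonnegative
initial value. Replace the nonlinearity by `F(s, w⁺) + γ H(w⁺ - w)`, with `w⁺ = w ⊔ 0`. It is still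
locally Lipschitz from `Y` to `X`, so a fixed point argument gives a solution `w = u + d` with `d`
small in `Y` (`IsSmoothing.exists_fixedPoint`).

Regrouped, the modified equation is `w' = (G - γH) w + [F(s, w⁺) + γ H w⁺]`. The bracket is
nonnegative for suitable `γ`, the semigroup generated by `G - γH` is positive, and the variation of
constants formula for that semigroup gives `w ≥ 0`. Then `w⁺ = w`, the modification vanishes, and
the Lipschitz estimate forces `d = 0`, so `u = w ≥ 0` (`exists_nonneg_of_mild`).

The delicate point is the passage from mild solutions for `G` to mild solutions for `G - γH`
(`Generates.mild_of_perturbed`). Values of mild solutions need not lie in the domain, but their time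
integrals do, so the comparison is made after integration. The short-time result then propagates to
every compact subinterval, since the set of times with `u ≥ 0` is closed and can always be continued
to the right. -/

namespace SemilinearACP

/-! ### Local boundedness and joint continuity of `C₀`-semigroups; Duhamel integrals. -/

section SemigroupBasics

variable {X : Type*} [NormedAddCommGroup X] [NormedSpace ℝ X]

namespace IsC0Semigroup

variable {S : ℝ → X →L[ℝ] X}

theorem exists_bound_near_zero [CompleteSpace X] (hS : IsC0Semigroup S) :
    ∃ δ : ℝ, 0 < δ ∧ ∃ M : ℝ, ∀ t ∈ Icc 0 δ, ‖S t‖ ≤ M := by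
  by_contra! hcon
  have hpos : ∀ n : ℕ, (0 : ℝ) < 1 / ((n : ℝ) + 1) := fun n => by positivity
  -- Exceeding `‖S 0‖` as well forces `t n ≠ 0`, so that convergence from the right applies and
  -- Banach–Steinhaus yields a contradiction.
  choose t ht hbig using fun n : ℕ =>
    hcon (1 / ((n : ℝ) + 1)) (hpos n) (max n ‖S 0‖)
  have htpos : ∀ n, 0 < t n := fun n => by
    refine lt_of_le_of_ne (ht n).1 fun h => ?_
    have := (le_max_right (n : ℝ) ‖S 0‖).trans_lt (hbig n)
    rw [← h] at this
    exact lt_irrefl _ this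
  have htend : Tendsto t atTop (𝓝[>] 0) := by
    refine tendsto_nhdsWithin_iff.2 ⟨?_, Eventually.of_forall htpos⟩
    exact squeeze_zero (fun n => (ht n).1) (fun n => (ht n).2)
      tendsto_one_div_add_atTop_nhds_zero_nat
  obtain ⟨C, hC⟩ := banach_steinhaus (g := fun n => S (t n)) fun x => by
    obtain ⟨C, hC⟩ := ((hS.tendsto_zero x).comp htend).norm.bddAbove_range
    exact ⟨C, fun n => hC ⟨n, rfl⟩⟩
  obtain ⟨n, hn⟩ := exists_nat_gt C
  exact absurd (hC n) (not_le.2 (hn.trans_le ((le_max_left _ _).trans (hbig n).le)))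

theorem exists_bound [CompleteSpace X] (hS : IsC0Semigroup S) (τ : ℝ) :
    ∃ M : ℝ, 0 ≤ M ∧ ∀ t ∈ Icc 0 τ, ‖S t‖ ≤ M := by
  obtain ⟨δ, hδ, M, hM⟩ := hS.exists_bound_near_zero
  have key : ∀ n : ℕ, ∃ C : ℝ, ∀ t ∈ Icc 0 (n * δ), ‖S t‖ ≤ C := by
    intro n
    induction n with
    | zero =>
      refine ⟨‖S 0‖, fun t ht => ?_⟩
      have : t = 0 := le_antisymm (by simpa using ht.2) ht.1
      rw [this]
    | succ n ih =>
      obtain ⟨C, hC⟩ := ih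
      have hM0 : 0 ≤ M := (norm_nonneg _).trans (hM 0 ⟨le_rfl, hδ.le⟩)
      refine ⟨max M (M * C), fun t ht => ?_⟩
      rcases le_total t δ with h | h
      · exact (hM t ⟨ht.1, h⟩).trans (le_max_left _ _)
      · refine le_trans ?_ (le_max_right _ _)
        have hmem : t - δ ∈ Icc 0 (n * δ) := by
          refine ⟨by linarith, ?_⟩
          have := ht.2
          push_cast at this
          linarith
        have hdec : S t = (S δ).comp (S (t - δ)) := by
          ext x
          have := hS.map_add δ (t - δ) hδ.le hmem.1 x
          rwa [add_sub_cancel] at this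
        rw [hdec]
        exact (ContinuousLinearMap.opNorm_comp_le _ _).trans
          (mul_le_mul (hM δ ⟨hδ.le, le_rfl⟩) (hC _ hmem) (norm_nonneg _) hM0)
  obtain ⟨n, hn⟩ := exists_nat_ge (τ / δ)
  obtain ⟨C, hC⟩ := key n
  exact ⟨max C 0, le_max_right _ _, fun t ht =>
    (hC t ⟨ht.1, ht.2.trans ((div_le_iff₀ hδ).1 hn)⟩).trans (le_max_left _ _)⟩

theorem tendsto_zero_right (hS : IsC0Semigroup S) (x : X) :
    Tendsto (fun t => S t x) (𝓝[≥] 0) (𝓝 x) := by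
  have h : ContinuousWithinAt (fun t => S t x) (Ioi 0) 0 := by
    simpa [ContinuousWithinAt, hS.map_zero x] using hS.tendsto_zero x
  simpa [ContinuousWithinAt, hS.map_zero x] using continuousWithinAt_Ioi_iff_Ici.1 h

/-- Local boundedness of `‖S t‖` reduces joint continuity to right continuity of orbits at `0`.
Clamping time at `0` gives a function on all of `ℝ × X`, so Duhamel integrands are continuous
everywhere. -/
theorem continuous_uncurry [CompleteSpace X] (hS : IsC0Semigroup S) :
    Continuous fun p : ℝ × X => S (max p.1 0) p.2 := by
  rw [continuous_iff_continuousAt]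
  rintro ⟨t₀, x₀⟩
  obtain ⟨M, hM0, hM⟩ := hS.exists_bound (max t₀ 0 + 1)
  have hmono : ∀ s t : ℝ, 0 ≤ s → s ≤ t → s ≤ max t₀ 0 + 1 →
      ‖S t x₀ - S s x₀‖ ≤ M * ‖S (t - s) x₀ - x₀‖ := by
    intro s t hs hst hs1
    have := hS.map_add s (t - s) hs (by linarith) x₀
    rw [add_sub_cancel] at this
    rw [this, ← map_sub]
    exact (S s).le_of_opNorm_le (hM s ⟨hs, hs1⟩) _
  have hnear : ∀ᶠ p : ℝ × X in 𝓝 (t₀, x₀), max p.1 0 ≤ max t₀ 0 + 1 := by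
    have hc : ContinuousAt (fun p : ℝ × X => max p.1 0) (t₀, x₀) := by fun_prop
    have hlt : max t₀ 0 < max t₀ 0 + 1 := by linarith
    filter_upwards [hc.eventually_lt_const hlt] with p hp using hp.le
  have hbound : ∀ᶠ p : ℝ × X in 𝓝 (t₀, x₀), ‖S (max p.1 0) p.2 - S (max t₀ 0) x₀‖ ≤
      M * ‖p.2 - x₀‖ + M * ‖S |max p.1 0 - max t₀ 0| x₀ - x₀‖ := by
    filter_upwards [hnear] with p hp
    have h1 : ‖S (max p.1 0) p.2 - S (max p.1 0) x₀‖ ≤ M * ‖p.2 - x₀‖ := by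
      rw [← map_sub]
      exact (S _).le_of_opNorm_le (hM _ ⟨le_max_right _ _, hp⟩) _
    have h2 : ‖S (max p.1 0) x₀ - S (max t₀ 0) x₀‖ ≤
        M * ‖S |max p.1 0 - max t₀ 0| x₀ - x₀‖ := by
      rcases le_total (max p.1 0) (max t₀ 0) with h | h
      · rw [abs_of_nonpos (by linarith), neg_sub, norm_sub_rev]
        exact hmono _ _ (le_max_right _ _) h hp
      · rw [abs_of_nonneg (by linarith)]
        exact hmono _ _ (le_max_right _ _) h (by linarith)
    calc _ = ‖(S (max p.1 0) p.2 - S (max p.1 0) x₀) +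
          (S (max p.1 0) x₀ - S (max t₀ 0) x₀)‖ := by rw [sub_add_sub_cancel]
      _ ≤ _ := (norm_add_le _ _).trans (add_le_add h1 h2)
  rw [ContinuousAt, tendsto_iff_norm_sub_tendsto_zero]
  refine squeeze_zero' (Eventually.of_forall fun _ => norm_nonneg _) hbound ?_
  have ha : Tendsto (fun p : ℝ × X => |max p.1 0 - max t₀ 0|) (𝓝 (t₀, x₀)) (𝓝[≥] 0) := by
    refine tendsto_nhdsWithin_iff.2 ⟨?_, Eventually.of_forall fun _ => mem_Ici.2 (abs_nonneg _)⟩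
    have hc : Continuous fun p : ℝ × X => |max p.1 0 - max t₀ 0| := by fun_prop
    simpa using hc.tendsto (t₀, x₀)
  have hb : Tendsto (fun p : ℝ × X => ‖S |max p.1 0 - max t₀ 0| x₀ - x₀‖) (𝓝 (t₀, x₀)) (𝓝 0) :=
    tendsto_iff_norm_sub_tendsto_zero.1 ((hS.tendsto_zero_right x₀).comp ha)
  have hc : Tendsto (fun p : ℝ × X => ‖p.2 - x₀‖) (𝓝 (t₀, x₀)) (𝓝 0) := by
    have hc : Continuous fun p : ℝ × X => ‖p.2 - x₀‖ := by fun_prop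
    simpa using hc.tendsto (t₀, x₀)
  simpa using (hc.const_mul M).add (hb.const_mul M)

theorem continuous_apply [CompleteSpace X] (hS : IsC0Semigroup S) {α : Type*}
    [TopologicalSpace α] {f : α → ℝ} {g : α → X} (hf : Continuous f) (hg : Continuous g) :
    Continuous fun a => S (max (f a) 0) (g a) :=
  hS.continuous_uncurry.comp (hf.prodMk hg)

end IsC0Semigroup

/-- The solution `t ↦ ∫₀ᵗ S (t - s) φ(s) ds`, `t ≥ 0`, of the inhomogeneous problem with zero
initial value. -/
noncomputable def duhamel (S : ℝ → X →L[ℝ] X) (φ : ℝ → X) (t : ℝ) : X :=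
  ∫ s in (0 : ℝ)..t, S (max (t - s) 0) (φ s)

theorem duhamel_eq {S : ℝ → X →L[ℝ] X} {φ : ℝ → X} {t : ℝ} (ht : 0 ≤ t) :
    duhamel S φ t = ∫ s in (0 : ℝ)..t, S (t - s) (φ s) := by
  refine intervalIntegral.integral_congr fun s hs => ?_
  rw [uIcc_of_le ht] at hs
  simp only [max_eq_left (sub_nonneg.2 hs.2)]

theorem duhamel_congr {S : ℝ → X →L[ℝ] X} {φ ψ : ℝ → X} {t : ℝ} (ht : 0 ≤ t)
    (h : ∀ s ∈ Icc 0 t, φ s = ψ s) : duhamel S φ t = duhamel S ψ t := by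
  refine intervalIntegral.integral_congr fun s hs => ?_
  rw [uIcc_of_le ht] at hs
  simp only [h s hs]

@[simp]
theorem duhamel_zero (S : ℝ → X →L[ℝ] X) (φ : ℝ → X) : duhamel S φ 0 = 0 := by
  simp [duhamel]

section

variable [CompleteSpace X] {S : ℝ → X →L[ℝ] X} (hS : IsC0Semigroup S)
include hS

theorem continuous_duhamel {φ : ℝ → X} (hφ : Continuous φ) : Continuous (duhamel S φ) :=
  intervalIntegral.continuous_parametric_intervalIntegral_of_continuous
    (f := fun t s => S (max (t - s) 0) (φ s))
    (hS.continuous_apply (by fun_prop) (by fun_prop)) continuous_id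

theorem intervalIntegrable_duhamel {φ : ℝ → X} (hφ : Continuous φ) (r a b : ℝ) :
    IntervalIntegrable (fun s => S (max (r - s) 0) (φ s)) MeasureTheory.volume a b :=
  (hS.continuous_apply (by fun_prop) hφ).intervalIntegrable _ _

theorem duhamel_add {φ ψ : ℝ → X} (hφ : Continuous φ) (hψ : Continuous ψ) (t : ℝ) :
    duhamel S (fun s => φ s + ψ s) t = duhamel S φ t + duhamel S ψ t := by
  simp only [duhamel, map_add]
  exact intervalIntegral.integral_add (intervalIntegrable_duhamel hS hφ _ _ _)
    (intervalIntegrable_duhamel hS hψ _ _ _)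

theorem duhamel_sub {φ ψ : ℝ → X} (hφ : Continuous φ) (hψ : Continuous ψ) (t : ℝ) :
    duhamel S (fun s => φ s - ψ s) t = duhamel S φ t - duhamel S ψ t := by
  simp only [duhamel, map_sub]
  exact intervalIntegral.integral_sub (intervalIntegrable_duhamel hS hφ _ _ _)
    (intervalIntegrable_duhamel hS hψ _ _ _)

theorem apply_duhamel {φ : ℝ → X} (hφ : Continuous φ) {r t : ℝ} (hr : 0 ≤ r) (ht : 0 ≤ t) :
    S r (duhamel S φ t) = ∫ s in (0 : ℝ)..t, S (max (r + t - s) 0) (φ s) := by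
  rw [duhamel, ← ContinuousLinearMap.intervalIntegral_comp_comm _
    (intervalIntegrable_duhamel hS hφ _ _ _)]
  refine intervalIntegral.integral_congr fun s hs => ?_
  rw [uIcc_of_le ht] at hs
  have h1 : 0 ≤ t - s := sub_nonneg.2 hs.2
  simp only [max_eq_left h1]
  rw [max_eq_left (by linarith), add_sub_assoc, hS.map_add r (t - s) hr h1]

theorem duhamel_apply {φ : ℝ → X} (hφ : Continuous φ) {r t : ℝ} (hr : 0 ≤ r) (ht : 0 ≤ t) :
    duhamel S (fun s => S r (φ s)) t = S r (duhamel S φ t) := by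
  rw [apply_duhamel hS hφ hr ht]
  refine intervalIntegral.integral_congr fun s hs => ?_
  rw [uIcc_of_le ht] at hs
  have h1 : 0 ≤ t - s := sub_nonneg.2 hs.2
  simp only [max_eq_left h1]
  rw [max_eq_left (by linarith), ← hS.map_add (t - s) r h1 hr]
  ring_nf

/-- The cocycle identity for the solution of the inhomogeneous problem. -/
theorem duhamel_add_time {φ : ℝ → X} (hφ : Continuous φ) {a h : ℝ} (ha : 0 ≤ a) (hh : 0 ≤ h) :
    duhamel S φ (a + h) = S h (duhamel S φ a) + duhamel S (fun s => φ (a + s)) h := by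
  have hshift : duhamel S (fun s => φ (a + s)) h =
      ∫ s in a..a + h, S (max (a + h - s) 0) (φ s) := by
    have := intervalIntegral.integral_comp_add_left (a := 0) (b := h)
      (fun s => S (max (a + h - s) 0) (φ s)) a
    rw [add_zero] at this
    rw [← this]
    refine intervalIntegral.integral_congr fun s _ => ?_
    simp only [add_sub_add_left_eq_sub]
  rw [hshift, apply_duhamel hS hφ hh ha, add_comm h a, intervalIntegral.integral_add_adjacent_intervals
    (intervalIntegrable_duhamel hS hφ _ _ _) (intervalIntegrable_duhamel hS hφ _ _ _), duhamel]

end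

theorem duhamel_nonneg [CompleteSpace X] [Lattice X] [IsOrderedAddMonoid X] [IsOrderedModule ℝ X]
    [HasSolidNorm X] {S : ℝ → X →L[ℝ] X} (hpos : IsPositiveSemigroup S) {φ : ℝ → X} {t : ℝ}
    (ht : 0 ≤ t) (hφ : ∀ s ∈ Icc 0 t, 0 ≤ φ s) : 0 ≤ duhamel S φ t := by
  rw [duhamel, intervalIntegral.integral_of_le ht]
  refine MeasureTheory.integral_nonneg_of_ae ?_
  refine (MeasureTheory.ae_restrict_iff' measurableSet_Ioc).2 (Eventually.of_forall fun s hs => ?_)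
  exact hpos _ (le_max_right _ _) _ (hφ s ⟨hs.1.le, hs.2⟩)

end SemigroupBasics

/-! ### Integrated mild solutions and uniqueness for the homogeneous problem. -/

section IntegratedSolutions

variable {X : Type*} [NormedAddCommGroup X] [NormedSpace ℝ X] [CompleteSpace X]

/-- The mild solution of `v' = A v + φ`, `v 0 = x` satisfies the integrated equation
`v t = x + A ∫₀ᵗ v + ∫₀ᵗ φ`. -/
theorem Generates.integral_mild_mem_graph {A : X →ₗ.[ℝ] X} {S : ℝ → X →L[ℝ] X}
    (hA : Generates A S) {φ : ℝ → X} (hφ : Continuous φ) (x : X) {v : ℝ → X}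
    (hv : v = fun t => S (max t 0) x + duhamel S φ t) {t : ℝ} (ht : 0 ≤ t) :
    (∫ s in (0 : ℝ)..t, v s, v t - x - ∫ s in (0 : ℝ)..t, φ s) ∈ A.graph := by
  have hS := hA.1
  have hvc : Continuous v := by
    rw [hv]
    exact (hS.continuous_apply continuous_id continuous_const).add (continuous_duhamel hS hφ)
  have hv0 : v 0 = x := by simp [hv, hS.map_zero]
  -- This is `h⁻¹` times the integral over `s` of the Duhamel terms on `[s, s + h]`. Rescaling to `θ
  -- ∈ [0, 1]` removes the singular factor and makes `J` continuous at `h = 0`.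
  set J : ℝ → X := fun h => ∫ s in (0 : ℝ)..t, ∫ θ in (0 : ℝ)..1,
    S (max (h * (1 - θ)) 0) (φ (s + h * θ)) with hJ
  have hJin : Continuous fun p : ℝ × ℝ => ∫ θ in (0 : ℝ)..1,
      S (max (p.1 * (1 - θ)) 0) (φ (p.2 + p.1 * θ)) :=
    intervalIntegral.continuous_parametric_intervalIntegral_of_continuous'
      (f := fun (p : ℝ × ℝ) θ => S (max (p.1 * (1 - θ)) 0) (φ (p.2 + p.1 * θ)))
      (hS.continuous_apply (by fun_prop) (by fun_prop)) 0 1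
  have hJc : Continuous J :=
    intervalIntegral.continuous_parametric_intervalIntegral_of_continuous'
      (f := fun h s => ∫ θ in (0 : ℝ)..1, S (max (h * (1 - θ)) 0) (φ (s + h * θ))) hJin 0 t
  have hJ0 : J 0 = ∫ s in (0 : ℝ)..t, φ s := by
    simp [hJ, hS.map_zero]
  have hquot : ∀ h : ℝ, 0 < h →
      h⁻¹ • (S h (∫ s in (0 : ℝ)..t, v s) - ∫ s in (0 : ℝ)..t, v s) =
        h⁻¹ • ((∫ s in (0 : ℝ)..(t + h), v s) - ∫ s in (0 : ℝ)..t, v s) -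
          h⁻¹ • ((∫ s in (0 : ℝ)..(0 + h), v s) - ∫ s in (0 : ℝ)..0, v s) - J h := by
    intro h hh
    have hstep : ∀ s ∈ uIcc 0 t, S h (v s) = v (s + h) -
        h • ∫ θ in (0 : ℝ)..1, S (max (h * (1 - θ)) 0) (φ (s + h * θ)) := by
      intro s hs
      rw [uIcc_of_le ht] at hs
      have h1 : duhamel S (fun r => φ (s + r)) h =
          h • ∫ θ in (0 : ℝ)..1, S (max (h * (1 - θ)) 0) (φ (s + h * θ)) := by
        have := intervalIntegral.smul_integral_comp_mul_left (a := 0) (b := 1)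
          (fun r => S (max (h - r) 0) (φ (s + r))) h
        rw [mul_zero, mul_one] at this
        rw [duhamel, ← this]
        simp only [mul_sub, mul_one]
      rw [← h1, hv]
      simp only [map_add, duhamel_add_time hS hφ hs.1 hh.le]
      rw [max_eq_left hs.1, max_eq_left (add_nonneg hs.1 hh.le), add_comm s h,
        hS.map_add h s hh.le hs.1]
      abel
    have hSw : S h (∫ s in (0 : ℝ)..t, v s) = (∫ s in h..(t + h), v s) - h • J h := by
      rw [← ContinuousLinearMap.intervalIntegral_comp_comm _ (hvc.intervalIntegrable _ _),
        intervalIntegral.integral_congr hstep]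
      have hc1 : Continuous fun s => v (s + h) := hvc.comp (continuous_add_const h)
      have hc2 : Continuous fun s => h • ∫ θ in (0 : ℝ)..1,
          S (max (h * (1 - θ)) 0) (φ (s + h * θ)) :=
        (hJin.comp (by fun_prop : Continuous fun s : ℝ => (h, s))).const_smul h
      rw [intervalIntegral.integral_sub (hc1.intervalIntegrable _ _) (hc2.intervalIntegrable _ _),
        intervalIntegral.integral_smul, intervalIntegral.integral_comp_add_right, zero_add]
    have hsplit : ∫ s in h..(t + h), v s =
        (∫ s in (0 : ℝ)..(t + h), v s) - ∫ s in (0 : ℝ)..h, v s :=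
      (intervalIntegral.integral_interval_sub_left (hvc.intervalIntegrable _ _)
        (hvc.intervalIntegrable _ _)).symm
    rw [hSw, hsplit, zero_add, intervalIntegral.integral_same, sub_zero, ← smul_sub]
    conv_rhs => rw [← one_smul ℝ (J h), ← inv_mul_cancel₀ hh.ne', mul_smul]
    rw [← smul_sub]
    congr 1
    abel
  have hderiv : ∀ r : ℝ, Tendsto (fun h : ℝ =>
      h⁻¹ • ((∫ s in (0 : ℝ)..(r + h), v s) - ∫ s in (0 : ℝ)..r, v s)) (𝓝[>] 0) (𝓝 (v r)) := by
    intro r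
    have := hasDerivAt_iff_tendsto_slope_zero.1 (intervalIntegral.integral_hasDerivAt_right
      (hvc.intervalIntegrable 0 r) hvc.stronglyMeasurable.stronglyMeasurableAtFilter
      hvc.continuousAt)
    exact this.mono_left (nhdsWithin_mono _ fun y hy => ne_of_gt hy)
  rw [hA.2]
  have hlim := ((hderiv t).sub (hderiv 0)).sub
    ((hJc.tendsto 0).mono_left nhdsWithin_le_nhds : Tendsto J (𝓝[>] 0) (𝓝 (J 0)))
  rw [hv0, hJ0] at hlim
  refine hlim.congr' ?_
  filter_upwards [self_mem_nhdsWithin] with h hh using (hquot h hh).symm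

/-- A classical solution of `D' = A D`, `D 0 = 0` vanishes. -/
theorem Generates.eq_zero_of_hasDerivAt {A : X →ₗ.[ℝ] X} {S : ℝ → X →L[ℝ] X}
    (hA : Generates A S) {D d : ℝ → X} {τ : ℝ} (hD : ∀ t, HasDerivAt D (d t) t) (hD0 : D 0 = 0)
    (hgraph : ∀ t ∈ Icc 0 τ, (D t, d t) ∈ A.graph) : ∀ t ∈ Icc 0 τ, D t = 0 := by
  intro t ht
  have hS := hA.1
  obtain ⟨M, hM0, hM⟩ := hS.exists_bound τ
  have hDc : Continuous D := continuous_iff_continuousAt.2 fun t => (hD t).continuousAt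
  -- This curve joins `S t (D 0) = 0` to `D t`, so it remains to see that its right derivative
  -- vanishes. Factoring `S (t - s) = S (t - r) S (r - s)` puts a uniformly bounded operator in
  -- front of the difference of two quotients, both converging to `d s`.
  set g : ℝ → X := fun s => S (max (t - s) 0) (D s) with hg
  have hgc : Continuous g := hS.continuous_apply (by fun_prop) hDc
  have hconst := constant_of_has_deriv_right_zero (f := g) (a := 0) (b := t) hgc.continuousOn ?_ t
    ⟨ht.1, le_rfl⟩
  · simpa [hg, hS.map_zero, hD0] using hconst
  · intro s hs
    rw [← hasDerivWithinAt_Ioi_iff_Ici, hasDerivWithinAt_iff_tendsto_slope' self_notMem_Ioi]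
    have hsub : Tendsto (fun r => r - s) (𝓝[>] s) (𝓝[>] 0) := by
      refine tendsto_nhdsWithin_iff.2 ⟨?_, ?_⟩
      · have hc : Continuous fun r : ℝ => r - s := by fun_prop
        simpa using (hc.tendsto s).mono_left nhdsWithin_le_nhds
      · filter_upwards [self_mem_nhdsWithin] with r hr using sub_pos.2 (mem_Ioi.1 hr)
    have h1 := (hD s).tendsto_slope_zero_right.comp hsub
    have h2 := ((hA.2 _ _).1 (hgraph s ⟨hs.1, hs.2.le.trans ht.2⟩)).comp hsub
    have h3 := (h1.sub h2).norm.const_mul M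
    rw [sub_self, norm_zero, mul_zero] at h3
    rw [tendsto_zero_iff_norm_tendsto_zero]
    refine squeeze_zero' (Eventually.of_forall fun _ => norm_nonneg _) ?_ h3
    filter_upwards [Ioc_mem_nhdsGT hs.2] with r hr
    have htr : 0 ≤ t - r := sub_nonneg.2 hr.2
    have hsr : 0 ≤ r - s := sub_nonneg.2 hr.1.le
    have hslope : slope g s r = S (t - r) ((r - s)⁻¹ • (D (s + (r - s)) - D s) -
        (r - s)⁻¹ • (S (r - s) (D s) - D s)) := by
      have hsum := hS.map_add (t - r) (r - s) htr hsr (D s)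
      rw [sub_add_sub_cancel] at hsum
      simp only [slope, hg, vsub_eq_sub]
      rw [max_eq_left htr, max_eq_left (by linarith), hsum, add_sub_cancel, ← smul_sub, map_smul,
        sub_sub_sub_cancel_right, map_sub]
    rw [hslope]
    exact (S _).le_of_opNorm_le (hM _ ⟨htr, by linarith [ht.2, hs.1, hr.1]⟩) _

end IntegratedSolutions

/-! ### Mild solutions under the perturbation `G - γH`. -/

section Perturbation

variable {X : Type*} [NormedAddCommGroup X] [NormedSpace ℝ X]
  {Y : Type*} [NormedAddCommGroup Y] [NormedSpace ℝ Y]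

theorem mem_graph_sub_operatorOn {ι : Y →L[ℝ] X} (hι : Function.Injective ι) {G : X →ₗ.[ℝ] X}
    {H : Y →ₗ[ℝ] X} {γ : ℝ} {y : Y} {z : X} (h : (ι y, z) ∈ G.graph) :
    (ι y, z - γ • H y) ∈ (G - γ • operatorOn ι hι H).graph := by
  obtain ⟨x, hx, hxz⟩ := (LinearPMap.mem_graph_iff G).1 h
  have hmem : ι y ∈ (G - γ • operatorOn ι hι H).domain :=
    ⟨by rw [← show (x : X) = ι y from hx]; exact x.2, ⟨y, rfl⟩⟩
  refine (LinearPMap.mem_graph_iff _).2 ⟨⟨ι y, hmem⟩, rfl, ?_⟩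
  have hH : operatorOn ι hι H ⟨ι y, hmem.2⟩ = H y := by
    have : (LinearEquiv.ofInjective (ι : Y →ₗ[ℝ] X) hι).symm ⟨ι y, hmem.2⟩ = y :=
      (LinearEquiv.symm_apply_eq _).2 rfl
    exact congrArg H this
  have hGx : G ⟨ι y, hmem.1⟩ = z := by
    rw [← show G x = z from hxz]
    exact congrArg G (Subtype.ext hx.symm)
  rw [LinearPMap.sub_apply, LinearPMap.smul_apply]
  exact congrArg₂ (fun a b : X => a - γ • b) hGx hH

/-- A mild solution of `y' = G y + (ψ - γ H y)` with values in `Y` is a mild solution of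
`y' = (G - γ H) y + ψ`. -/
theorem Generates.mild_of_perturbed [CompleteSpace X] [CompleteSpace Y] {ι : Y →L[ℝ] X}
    (hι : Function.Injective ι)
    {G : X →ₗ.[ℝ] X} {S S' : ℝ → X →L[ℝ] X} (hG : Generates G S) {H : Y →ₗ[ℝ] X}
    (hH : Continuous H) {γ : ℝ} (hG' : Generates (G - γ • operatorOn ι hι H) S')
    {ψ : ℝ → X} (hψ : Continuous ψ) {y : ℝ → Y} (hy : Continuous y) {x : X} {τ : ℝ}
    (hmild : ∀ t ∈ Icc 0 τ, ι (y t) = S t x + duhamel S (fun s => ψ s - γ • H (y s)) t) :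
    ∀ t ∈ Icc 0 τ, ι (y t) = S' t x + duhamel S' ψ t := by
  have hHy : Continuous fun s => γ • H (y s) := (hH.comp hy).const_smul γ
  have hιy : Continuous fun s => ι (y s) := ι.continuous.comp hy
  set v : ℝ → X := fun t => S' (max t 0) x + duhamel S' ψ t with hv
  have hvc : Continuous v :=
    (hG'.1.continuous_apply continuous_id continuous_const).add (continuous_duhamel hG'.1 hψ)
  have hdiff : Continuous fun t => ι (y t) - v t := hιy.sub hvc
  -- Integrating the difference of the two candidates puts it in the domain, where it is a classical
  -- solution of the homogeneous problem.
  set D : ℝ → X := fun t => ∫ s in (0 : ℝ)..t, (ι (y s) - v s) with hD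
  have hDd : ∀ t, HasDerivAt D (ι (y t) - v t) t := fun t =>
    intervalIntegral.integral_hasDerivAt_right (hdiff.intervalIntegrable 0 t)
      hdiff.stronglyMeasurable.stronglyMeasurableAtFilter hdiff.continuousAt
  have hgraph : ∀ t ∈ Icc 0 τ, (D t, ι (y t) - v t) ∈ (G - γ • operatorOn ι hι H).graph := by
    intro t ht
    have h1 := hG.integral_mild_mem_graph (φ := fun s => ψ s - γ • H (y s))
      (hψ.sub hHy) x rfl ht.1
    -- The integral is taken in `Y`, so that `H` can be applied to it and, being continuous,
    -- commutes with it.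
    have hint : ∫ s in (0 : ℝ)..t, (S (max s 0) x + duhamel S (fun s => ψ s - γ • H (y s)) s) =
        ι (∫ s in (0 : ℝ)..t, y s) := by
      rw [← ContinuousLinearMap.intervalIntegral_comp_comm _ (hy.intervalIntegrable _ _)]
      refine intervalIntegral.integral_congr fun s hs => ?_
      rw [uIcc_of_le ht.1] at hs
      simp only [max_eq_left hs.1, hmild s ⟨hs.1, hs.2.trans ht.2⟩]
    have hHint : H (∫ s in (0 : ℝ)..t, y s) = ∫ s in (0 : ℝ)..t, H (y s) :=
      (ContinuousLinearMap.intervalIntegral_comp_comm (⟨H, hH⟩ : Y →L[ℝ] X)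
        (hy.intervalIntegrable 0 t)).symm
    rw [hint, max_eq_left ht.1, ← hmild t ht, intervalIntegral.integral_sub
      (hψ.intervalIntegrable _ _) (hHy.intervalIntegrable _ _),
      intervalIntegral.integral_smul] at h1
    have h2 := mem_graph_sub_operatorOn (γ := γ) hι (H := H) h1
    have h3 := hG'.integral_mild_mem_graph hψ x hv ht.1
    have h4 := Submodule.sub_mem _ h2 h3
    convert h4 using 1
    refine Prod.ext ?_ ?_
    · simp only [hD, Prod.fst_sub]
      rw [intervalIntegral.integral_sub (hιy.intervalIntegrable _ _)
        (hvc.intervalIntegrable _ _),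
        ContinuousLinearMap.intervalIntegral_comp_comm _ (hy.intervalIntegrable _ _)]
    · simp only [Prod.snd_sub, hHint]
      abel
  have hzero := hG'.eq_zero_of_hasDerivAt hDd (by simp [hD]) hgraph
  intro t ht
  -- Since `D` vanishes, so does its image under the generator, which is the difference itself.
  have := LinearPMap.graph_fst_eq_zero_snd _ (hgraph t ht) (hzero t ht)
  rw [sub_eq_zero.1 this]
  simp only [hv, max_eq_left ht.1]

end Perturbation

/-! ### Automatic continuity of positive operators. -/

section PositiveOperators

/-- Positive linear operators from a Banach lattice to a normed lattice are continuous. -/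
theorem continuous_of_map_nonneg
    {X : Type*} [NormedAddCommGroup X] [NormedSpace ℝ X]
    [Lattice X] [IsOrderedAddMonoid X] [HasSolidNorm X]
    {Y : Type*} [NormedAddCommGroup Y] [NormedSpace ℝ Y] [CompleteSpace Y]
    [Lattice Y] [IsOrderedAddMonoid Y] [IsOrderedModule ℝ Y] [HasSolidNorm Y]
    (H : Y →ₗ[ℝ] X) (hH : ∀ y : Y, 0 ≤ y → 0 ≤ H y) : Continuous H := by
  have hmono : ∀ y z : Y, y ≤ z → H y ≤ H z := fun y z h => by
    have := hH (z - y) (sub_nonneg.2 h)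
    rwa [map_sub, sub_nonneg] at this
  have hsolid : ∀ y z : Y, |y| ≤ z → ‖H y‖ ≤ ‖H z‖ := fun y z h => by
    refine norm_le_norm_of_abs_le_abs ?_
    rw [abs_of_nonneg (hH z ((abs_nonneg y).trans h))]
    refine abs_le'.2 ⟨hmono _ _ ((le_abs_self y).trans h), ?_⟩
    rw [← map_neg]
    exact hmono _ _ ((neg_le_abs y).trans h)
  by_contra hcon
  -- If `H` were unbounded, the convergent sum of all `|y n|` would dominate each `y n`, so by
  -- positivity its image would have norm at least `‖H (y n)‖ > n` for all `n`.
  have hunb : ∀ n : ℕ, ∃ y : Y, ‖y‖ ≤ (1 / 2) ^ n ∧ (n : ℝ) < ‖H y‖ := by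
    by_contra! hn
    obtain ⟨n, hn⟩ := hn
    refine hcon (AddMonoidHomClass.continuous_of_bound H (n * 2 ^ n) fun y => ?_)
    rcases eq_or_ne y 0 with rfl | hy
    · simp
    have hy' : 0 < ‖y‖ := norm_pos_iff.2 hy
    have hc : 0 < (1 / 2 : ℝ) ^ n / ‖y‖ := by positivity
    have h1 := hn (((1 / 2 : ℝ) ^ n / ‖y‖) • y) (by
      rw [norm_smul, Real.norm_of_nonneg hc.le, div_mul_cancel₀ _ hy'.ne'])
    rw [map_smul, norm_smul, Real.norm_of_nonneg hc.le, div_mul_eq_mul_div, div_le_iff₀ hy',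
      one_div, inv_pow, inv_mul_le_iff₀ (by positivity)] at h1
    linarith
  choose y hy hHy using hunb
  have hsum : Summable fun n => |y n| :=
    Summable.of_norm_bounded (summable_geometric_of_lt_one (by norm_num) (by norm_num : (1 / 2 : ℝ) < 1))
      fun n => by rw [norm_abs_eq_norm]; exact hy n
  obtain ⟨n, hn⟩ := exists_nat_gt ‖H (∑' n, |y n|)‖
  exact lt_irrefl _ ((hHy n).trans_le
    ((hsolid _ _ (hsum.le_tsum n fun _ _ => abs_nonneg _)).trans hn.le))

end PositiveOperators

/-! ### Duhamel integrals with values in `Y` and short-time solvability. -/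

section Smoothing

variable {X : Type*} [NormedAddCommGroup X] [NormedSpace ℝ X]
  {Y : Type*} [NormedAddCommGroup Y] [NormedSpace ℝ Y]

/-- The inhomogeneous problem with zero initial value has solutions in `Y`, with norm control. -/
def IsSmoothing (ι : Y →L[ℝ] X) (S : ℝ → X →L[ℝ] X) (η : ℝ → ℝ) : Prop :=
  ∀ t : ℝ, 0 < t → ∀ φ : ℝ → X, Continuous φ → ∀ C : ℝ, (∀ s ∈ Icc 0 t, ‖φ s‖ ≤ C) →
    ∃ y : Y, ι y = duhamel S φ t ∧ ‖y‖ ≤ η t * C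

theorem IsSmoothing.exists_bounded {ι : Y →L[ℝ] X} {S : ℝ → X →L[ℝ] X} {η : ℝ → ℝ}
    (hsm : IsSmoothing ι S η) {ε δ : ℝ} (hε : 0 ≤ ε)
    (hηε : ∀ t ∈ Ioc 0 δ, η t ≤ ε) {φ : ℝ → X} (hφ : Continuous φ) {C : ℝ}
    (hC : ∀ s ∈ Icc 0 δ, ‖φ s‖ ≤ C) {t : ℝ} (ht : t ∈ Icc 0 δ) :
    ∃ y : Y, ι y = duhamel S φ t ∧ ‖y‖ ≤ ε * C := by
  have hC0 : 0 ≤ C := (norm_nonneg _).trans (hC t ht)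
  rcases ht.1.eq_or_lt with rfl | h
  · exact ⟨0, by simp, by simpa using mul_nonneg hε hC0⟩
  · obtain ⟨y, hy, hyC⟩ := hsm t h φ hφ C fun s hs => hC s ⟨hs.1, hs.2.trans ht.2⟩
    exact ⟨y, hy, hyC.trans (mul_le_mul_of_nonneg_right (hηε t ⟨h, ht.2⟩) hC0)⟩

/-- The increment of the Duhamel integral from `t` to `t + h` is a Duhamel integral over `[0, t]` of
the increment of `φ`, small by uniform continuity, plus one over `[0, h]`, small because `η h → 0`.
-/
theorem IsSmoothing.continuousOn [CompleteSpace X] {ι : Y →L[ℝ] X} (hι : Function.Injective ι)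
    {S : ℝ → X →L[ℝ] X} (hS : IsC0Semigroup S) {η : ℝ → ℝ} (hη : Tendsto η (𝓝[>] 0) (𝓝 0))
    (hsm : IsSmoothing ι S η) {ε δ : ℝ} (hε : 0 < ε) (hηε : ∀ t ∈ Ioc 0 δ, η t ≤ ε)
    {φ : ℝ → X} (hφ : Continuous φ) {k : ℝ → Y} (hk : ∀ t ∈ Icc 0 δ, ι (k t) = duhamel S φ t) :
    ContinuousOn k (Icc 0 δ) := by
  obtain ⟨M, hM0, hM⟩ := hS.exists_bound δ
  obtain ⟨C, hC⟩ := isCompact_Icc.exists_bound_of_continuousOn (hφ.continuousOn (s := Icc 0 δ))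
  have hstep : ∀ e > 0, ∃ κ > 0, ∀ t h : ℝ, 0 ≤ t → 0 < h → t + h ≤ δ → h < κ →
      ‖k (t + h) - k t‖ ≤ e := by
    intro e he
    have huc := isCompact_Icc.uniformContinuousOn_of_continuous
      (hφ.continuousOn (s := Icc 0 δ))
    obtain ⟨κ₁, hκ₁, h1⟩ := Metric.uniformContinuousOn_iff.1 huc (e / (2 * ε)) (by positivity)
    have hlim : Tendsto (fun h => η h * (M * C)) (𝓝[>] 0) (𝓝 0) := by
      simpa using hη.mul_const (M * C)
    obtain ⟨κ₂, hκ₂, h2⟩ := mem_nhdsGT_iff_exists_Ioo_subset.1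
      (hlim.eventually_lt_const (half_pos he))
    refine ⟨min κ₁ κ₂, lt_min hκ₁ hκ₂, fun t h ht hh hth hlt => ?_⟩
    -- Moving `S t` inside the integral means that only its norm on `X` enters, and no bound on `Y`
    -- is needed.
    obtain ⟨y₁, hy₁, hb₁⟩ := hsm h hh (fun s => S t (φ s)) ((S t).continuous.comp hφ) (M * C)
      fun s hs => (S t).le_of_opNorm_le_of_le (hM t ⟨ht, by linarith⟩)
        (hC s ⟨hs.1, by linarith [hs.2]⟩)
    have hcs : Continuous fun s => φ (h + s) := hφ.comp (continuous_const_add h)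
    have h3 : ∃ y₂ : Y, ι y₂ = duhamel S (fun s => φ (h + s) - φ s) t ∧
        ‖y₂‖ ≤ ε * (e / (2 * ε)) := by
      refine hsm.exists_bounded (δ := t) hε.le (fun r hr => hηε r ⟨hr.1, by linarith [hr.2]⟩)
        (hcs.sub hφ) (fun s hs => ?_) ⟨ht, le_rfl⟩
      change ‖φ (h + s) - φ s‖ ≤ _
      rw [← dist_eq_norm]
      refine (h1 _ ⟨by linarith [hs.1], by linarith [hs.2]⟩ _ ⟨hs.1, by linarith [hs.2]⟩ ?_).le
      rw [Real.dist_eq, add_sub_cancel_right, abs_of_pos hh]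
      exact hlt.trans_le (min_le_left _ _)
    obtain ⟨y₂, hy₂, hb₂⟩ := h3
    have heq : k (t + h) - k t = y₁ + y₂ := by
      apply hι
      rw [map_sub, map_add, hk _ ⟨by linarith, hth⟩, hk t ⟨ht, by linarith⟩, hy₁, hy₂,
        duhamel_apply hS hφ ht hh.le, duhamel_sub hS hcs hφ, add_comm t h,
        duhamel_add_time hS hφ hh.le ht]
      abel
    have h4 : ε * (e / (2 * ε)) = e / 2 := by field_simp
    have h5 : η h * (M * C) < e / 2 := h2 ⟨hh, hlt.trans_le (min_le_right _ _)⟩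
    rw [heq]
    linarith [norm_add_le y₁ y₂]
  rw [Metric.continuousOn_iff]
  intro t ht e he
  obtain ⟨κ, hκ, hst⟩ := hstep (e / 2) (half_pos he)
  refine ⟨κ, hκ, fun r hr hrt => ?_⟩
  rw [dist_eq_norm]
  rw [Real.dist_eq] at hrt
  rcases lt_trichotomy r t with h | rfl | h
  · have := hst r (t - r) hr.1 (by linarith) (by linarith [ht.2])
      (by rw [abs_of_neg (by linarith)] at hrt; linarith)
    rw [add_sub_cancel, norm_sub_rev] at this
    linarith
  · simpa using he
  · have := hst t (r - t) ht.1 (by linarith) (by linarith [hr.2])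
      (by rw [abs_of_pos (by linarith)] at hrt; linarith)
    rw [add_sub_cancel] at this
    linarith

/-- Small solutions of `d' = G d + g(s, d)`, `d 0 = 0` on short time intervals. -/
theorem IsSmoothing.exists_fixedPoint [CompleteSpace X] [CompleteSpace Y] {ι : Y →L[ℝ] X}
    (hι : Function.Injective ι)
    {S : ℝ → X →L[ℝ] X} (hS : IsC0Semigroup S) {η : ℝ → ℝ} (hη : Tendsto η (𝓝[>] 0) (𝓝 0))
    (hsm : IsSmoothing ι S η) {ε δ : ℝ} (hε : 0 < ε) (hδ : 0 < δ) (hηε : ∀ t ∈ Ioc 0 δ, η t ≤ ε)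
    {g : ℝ → Y → X} (hg : Continuous fun p : ℝ × Y => g p.1 p.2) {C L : ℝ}
    (hL : 0 ≤ L)
    (hgC : ∀ s ∈ Icc 0 δ, ‖g s 0‖ ≤ C)
    (hgL : ∀ s ∈ Icc 0 δ, ∀ d d' : Y, ‖d‖ ≤ 1 → ‖d'‖ ≤ 1 → ‖g s d - g s d'‖ ≤ L * ‖d - d'‖)
    (hεL : ε * L < 1) (hεLC : ε * (L + C) ≤ 1) :
    ∃ d : ℝ → Y, Continuous d ∧ (∀ s, ‖d s‖ ≤ 1) ∧
      ∀ t ∈ Icc 0 δ, ι (d t) = duhamel S (fun s => g s (d s)) t := by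
  set E : C(Icc 0 δ, Y) → ℝ → Y := fun f => IccExtend hδ.le f with hE
  have hEc : ∀ f, Continuous (E f) := fun f => f.continuous.Icc_extend'
  have hEn : ∀ f s, ‖E f s‖ ≤ ‖f‖ := fun f s => f.norm_coe_le_norm _
  have hEd : ∀ f f' s, ‖E f s - E f' s‖ ≤ dist f f' := fun f f' s => by
    rw [← dist_eq_norm]; exact ContinuousMap.dist_apply_le_dist _
  have hgc : ∀ f, Continuous fun s => g s (E f s) := fun f =>
    hg.comp (continuous_id.prodMk (hEc f))
  have hex : ∀ f : C(Icc 0 δ, Y), ∃ k : C(Icc 0 δ, Y), ∀ t : Icc 0 δ,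
      ι (k t) = duhamel S (fun s => g s (E f s)) t := by
    intro f
    obtain ⟨C', hC'⟩ := isCompact_Icc.exists_bound_of_continuousOn
      ((hgc f).continuousOn (s := Icc 0 δ))
    have : ∀ t : ℝ, ∃ y : Y, t ∈ Icc 0 δ → ι y = duhamel S (fun s => g s (E f s)) t := by
      intro t
      by_cases ht : t ∈ Icc 0 δ
      · obtain ⟨y, hy, -⟩ := hsm.exists_bounded hε.le hηε (hgc f) hC' ht
        exact ⟨y, fun _ => hy⟩
      · exact ⟨0, fun h => absurd h ht⟩
    choose k hk using this
    have hkc := hsm.continuousOn hι hS hη hε hηε (hgc f) hk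
    exact ⟨⟨fun t => k t, continuousOn_iff_continuous_domRestrict.1 hkc⟩, fun t => hk t t.2⟩
  choose Φ hΦ using hex
  have hΦn : ∀ f, ‖f‖ ≤ 1 → ‖Φ f‖ ≤ 1 := by
    intro f hf
    refine (ContinuousMap.norm_le _ zero_le_one).2 fun t => ?_
    have hb : ∀ s ∈ Icc 0 δ, ‖g s (E f s)‖ ≤ L + C := fun s hs => by
      have h1 := hgL s hs (E f s) 0 ((hEn f s).trans hf) (by simp)
      rw [sub_zero] at h1
      have h2 := mul_le_mul_of_nonneg_left ((hEn f s).trans hf) hL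
      calc _ = ‖(g s (E f s) - g s 0) + g s 0‖ := by rw [sub_add_cancel]
        _ ≤ _ := norm_add_le _ _
        _ ≤ _ := by linarith [hgC s hs]
    obtain ⟨y, hy, hyn⟩ := hsm.exists_bounded hε.le hηε (hgc f) hb t.2
    rw [hι ((hΦ f t).trans hy.symm)]
    exact hyn.trans hεLC
  have hΦd : ∀ f f', ‖f‖ ≤ 1 → ‖f'‖ ≤ 1 → dist (Φ f) (Φ f') ≤ ε * L * dist f f' := by
    intro f f' hf hf'
    refine (ContinuousMap.dist_le (by positivity)).2 fun t => ?_
    obtain ⟨y, hy, hyn⟩ := hsm.exists_bounded hε.le hηε ((hgc f).sub (hgc f'))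
      (C := L * dist f f') (fun s hs => (hgL s hs _ _ ((hEn f s).trans hf)
        ((hEn f' s).trans hf')).trans (mul_le_mul_of_nonneg_left (hEd f f' s) hL)) t.2
    have : Φ f t - Φ f' t = y := by
      apply hι
      rw [map_sub, hΦ, hΦ, hy]
      exact (duhamel_sub hS (hgc f) (hgc f') _).symm
    rw [dist_eq_norm, this, mul_assoc]
    exact hyn
  -- Contraction on the closed unit ball: `ε * (L + C) ≤ 1` makes the ball invariant, `ε * L < 1`
  -- gives the contraction.
  have hmaps : MapsTo Φ (Metric.closedBall 0 1) (Metric.closedBall 0 1) := fun f hf =>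
    mem_closedBall_zero_iff.2 (hΦn f (mem_closedBall_zero_iff.1 hf))
  have hcontr : ContractingWith (⟨ε * L, by positivity⟩ : NNReal)
      (hmaps.restrict Φ (Metric.closedBall 0 1) (Metric.closedBall 0 1)) := by
    refine ⟨hεL, LipschitzWith.of_dist_le_mul fun f f' => ?_⟩
    exact hΦd f f' (mem_closedBall_zero_iff.1 f.2) (mem_closedBall_zero_iff.1 f'.2)
  obtain ⟨f, hf, hfix, -⟩ := hcontr.exists_fixedPoint' Metric.isClosed_closedBall.isComplete
    hmaps (Metric.mem_closedBall_self zero_le_one) (edist_ne_top _ _)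
  refine ⟨E f, hEc f, fun s => (hEn f s).trans (mem_closedBall_zero_iff.1 hf), fun t ht => ?_⟩
  have h1 := hΦ f ⟨t, ht⟩
  rw [hfix.eq] at h1
  simpa [hE, IccExtend_of_mem hδ.le f ht] using h1

end Smoothing

/-! ### Short-time positivity. -/

variable {X : Type*} [NormedAddCommGroup X] [NormedSpace ℝ X] [CompleteSpace X]
  [Lattice X] [IsOrderedAddMonoid X] [IsOrderedModule ℝ X] [HasSolidNorm X]
  {Y : Type*} [NormedAddCommGroup Y] [NormedSpace ℝ Y] [CompleteSpace Y]
  [Lattice Y] [IsOrderedAddMonoid Y] [HasSolidNorm Y]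

/-- Short-time positivity of mild solutions with positive initial value. -/
theorem exists_nonneg_of_mild {ι : Y →L[ℝ] X} (hι : Function.Injective ι)
    (hnn : ∀ y : Y, 0 ≤ y ↔ 0 ≤ ι y)
    {G : X →ₗ.[ℝ] X} {S : ℝ → X →L[ℝ] X} (hG : Generates G S)
    {η : ℝ → ℝ} (hη : Tendsto η (𝓝[>] 0) (𝓝 0)) (hsm : IsSmoothing ι S η)
    {H : Y →ₗ[ℝ] X} (hH : Continuous H) {γ : ℝ} (hγ : 0 ≤ γ)
    {S' : ℝ → X →L[ℝ] X} (hG' : Generates (G - γ • operatorOn ι hι H) S')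
    (hpos : IsPositiveSemigroup S')
    {F : ℝ → Y → X} (hF : Continuous fun p : ℝ × Y => F p.1 p.2) {u : ℝ → Y} (hu : Continuous u)
    {ρ R L : ℝ} (hρ : 0 < ρ) (huR : ∀ s, ‖u s‖ + 1 ≤ R) (hL : 0 ≤ L)
    (hFL : ∀ s ∈ Icc 0 ρ, ∀ v w : Y, ‖v‖ ≤ R → ‖w‖ ≤ R → ‖F s v - F s w‖ ≤ L * ‖v - w‖)
    (hFpos : ∀ s ∈ Icc 0 ρ, ∀ v : Y, 0 ≤ v → ‖v‖ ≤ R → 0 ≤ F s v + γ • H v)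
    {x : X} (hx : 0 ≤ x)
    (hmild : ∀ t ∈ Icc 0 ρ, ι (u t) = S t x + duhamel S (fun s => F s (u s)) t) :
    ∃ δ : ℝ, 0 < δ ∧ δ ≤ ρ ∧ ∀ t ∈ Icc 0 δ, 0 ≤ u t := by
  have hS := hG.1
  obtain ⟨K, hK0, hK⟩ : ∃ K : ℝ, 0 ≤ K ∧ ∀ y : Y, ‖H y‖ ≤ K * ‖y‖ :=
    ⟨_, norm_nonneg (⟨H, hH⟩ : Y →L[ℝ] X), (⟨H, hH⟩ : Y →L[ℝ] X).le_opNorm⟩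
  -- The modified nonlinearity at `u + d` minus the original one at `u`: the right-hand side of the
  -- equation for the correction `d`.
  set g : ℝ → Y → X := fun s d =>
    F s ((u s + d) ⊔ 0) + γ • H ((u s + d) ⊔ 0 - (u s + d)) - F s (u s) with hg
  have hsum : Continuous fun p : ℝ × Y => u p.1 + p.2 := by fun_prop
  have hsup : Continuous fun p : ℝ × Y => (u p.1 + p.2) ⊔ 0 := hsum.sup continuous_const
  have hgc : Continuous fun p : ℝ × Y => g p.1 p.2 :=
    ((hF.comp (continuous_fst.prodMk hsup)).add
      ((hH.comp (hsup.sub hsum)).const_smul γ)).sub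
      (hF.comp (continuous_fst.prodMk (hu.comp continuous_fst)))
  have hsupn : ∀ v : Y, ‖v ⊔ 0‖ ≤ ‖v‖ := fun v => by
    simpa using norm_sup_sub_sup_le_norm v 0 0
  have hbd : ∀ s d, ‖d‖ ≤ 1 → ‖u s + d‖ ≤ R := fun s d hd =>
    (norm_add_le _ _).trans ((by linarith : _ ≤ ‖u s‖ + 1).trans (huR s))
  -- The positive part is 1-Lipschitz, hence `v ↦ v⁺ - v` is 2-Lipschitz; this is the source of `K *
  -- 2`.
  have hgL : ∀ s ∈ Icc 0 ρ, ∀ d d' : Y, ‖d‖ ≤ 1 → ‖d'‖ ≤ 1 →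
      ‖g s d - g s d'‖ ≤ (L + γ * (K * 2)) * ‖d - d'‖ := by
    intro s hs d d' hd hd'
    have hdd : u s + d - (u s + d') = d - d' := add_sub_add_left_eq_sub _ _ _
    have h0 : ‖(u s + d) ⊔ 0 - (u s + d') ⊔ 0‖ ≤ ‖d - d'‖ := by
      simpa only [hdd] using norm_sup_sub_sup_le_norm (u s + d) (u s + d') 0
    have h1 : ‖F s ((u s + d) ⊔ 0) - F s ((u s + d') ⊔ 0)‖ ≤ L * ‖d - d'‖ :=
      (hFL s hs _ _ ((hsupn _).trans (hbd s d hd)) ((hsupn _).trans (hbd s d' hd'))).trans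
        (mul_le_mul_of_nonneg_left h0 hL)
    have h2 : ‖H (((u s + d) ⊔ 0 - (u s + d') ⊔ 0) - (d - d'))‖ ≤ K * (2 * ‖d - d'‖) := by
      refine (hK _).trans (mul_le_mul_of_nonneg_left ?_ hK0)
      linarith [norm_sub_le ((u s + d) ⊔ 0 - (u s + d') ⊔ 0) (d - d')]
    have heq : g s d - g s d' = (F s ((u s + d) ⊔ 0) - F s ((u s + d') ⊔ 0)) +
        γ • H (((u s + d) ⊔ 0 - (u s + d') ⊔ 0) - (d - d')) := by
      simp only [hg, map_sub, map_add, smul_sub, smul_add]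
      abel
    rw [heq]
    refine (norm_add_le _ _).trans ?_
    rw [norm_smul, Real.norm_of_nonneg hγ]
    linarith [mul_le_mul_of_nonneg_left h2 hγ]
  obtain ⟨C, hC⟩ := isCompact_Icc.exists_bound_of_continuousOn
    ((hgc.comp (continuous_id.prodMk continuous_const : Continuous fun s : ℝ =>
      (s, (0 : Y)))).continuousOn (s := Icc 0 ρ))
  have hC0 : 0 ≤ C := (norm_nonneg _).trans (hC 0 ⟨le_rfl, hρ.le⟩)
  set L' := L + γ * (K * 2) with hL'
  have hLL' : L ≤ L' := le_add_of_nonneg_right (by positivity)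
  -- Chosen so that both smallness conditions of the fixed point argument hold.
  set ε := 1 / (2 * (L' + C + 1)) with hε
  have hden : 0 < L' + C + 1 := by positivity
  have hε0 : 0 < ε := by positivity
  have hεeq : ε * (L' + C + 1) = 1 / 2 := by rw [hε]; field_simp
  have hεL' : ε * L' < 1 := by nlinarith
  have hεLC : ε * (L' + C) ≤ 1 := by nlinarith
  obtain ⟨κ, hκ, hηκ⟩ := mem_nhdsGT_iff_exists_Ioo_subset.1 (hη.eventually_lt_const hε0)
  have hκ' : 0 < κ := hκ
  set δ := min ρ (κ / 2) with hδ
  have hδ0 : 0 < δ := lt_min hρ (half_pos hκ')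
  have hδρ : δ ≤ ρ := min_le_left _ _
  have hηε : ∀ t ∈ Ioc 0 δ, η t ≤ ε := fun t ht =>
    (hηκ ⟨ht.1, by linarith [ht.2, min_le_right ρ (κ / 2)]⟩ : η t < ε).le
  have hmem : ∀ s ∈ Icc 0 δ, s ∈ Icc 0 ρ := fun s hs => ⟨hs.1, hs.2.trans hδρ⟩
  obtain ⟨d, hdc, hd1, hd⟩ := hsm.exists_fixedPoint hι hS hη hε0 hδ0 hηε hgc
    (hL.trans hLL') (fun s hs => hC s (hmem s hs)) (fun s hs => hgL s (hmem s hs)) hεL' hεLC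
  set w : ℝ → Y := fun s => u s + d s with hw
  have hwc : Continuous w := hu.add hdc
  have hgdc : Continuous fun s => g s (d s) := hgc.comp (continuous_id.prodMk hdc)
  have hFuc : Continuous fun s => F s (u s) := hF.comp (continuous_id.prodMk hu)
  have hwsup : Continuous fun s => w s ⊔ 0 := hwc.sup continuous_const
  -- The term `-γ H w` is absorbed into the generator; what remains is the nonnegative
  -- inhomogeneity.
  have hwmild := hG.mild_of_perturbed hι hH hG' (ψ := fun s => F s (w s ⊔ 0) + γ • H (w s ⊔ 0))
    ((hF.comp (continuous_id.prodMk hwsup)).add ((hH.comp hwsup).const_smul γ)) hwc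
    (x := x) (τ := δ) fun t ht => by
      rw [show ι (w t) = ι (u t) + ι (d t) from map_add _ _ _, hmild t (hmem t ht), hd t ht,
        add_assoc, ← duhamel_add hS hFuc hgdc]
      congr 2
      funext s
      simp only [hg, hw, map_sub, smul_sub]
      abel
  have hwnn : ∀ t ∈ Icc 0 δ, 0 ≤ w t := by
    intro t ht
    rw [hnn, hwmild t ht]
    refine add_nonneg (hpos t ht.1 x hx) (duhamel_nonneg hpos ht.1 fun s hs => ?_)
    exact hFpos s (hmem s ⟨hs.1, hs.2.trans ht.2⟩) _ le_sup_right
      ((hsupn _).trans (hbd s _ (hd1 s)))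
  -- Uniqueness: as `w ≥ 0`, the forcing of `d` is just `F(s, u + d) - F(s, u)`. At a maximum of
  -- `‖d‖` the smoothing estimate gives `‖d‖ ≤ ε L ‖d‖` with `ε L < 1`.
  obtain ⟨t₀, ht₀, hmax⟩ := isCompact_Icc.exists_isMaxOn (nonempty_Icc.2 hδ0.le)
    (hdc.norm.continuousOn (s := Icc 0 δ))
  have hdsmall : ‖d t₀‖ ≤ ε * (L * ‖d t₀‖) := by
    have hb : ∀ s ∈ Icc 0 δ, ‖g s (d s)‖ ≤ L * ‖d t₀‖ := fun s hs => by
      have hws : (u s + d s) ⊔ 0 = u s + d s := sup_eq_left.2 (hwnn s hs)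
      have h1 := hFL s (hmem s hs) (u s + d s) (u s) (hbd s _ (hd1 s))
        (by linarith [huR s])
      rw [add_sub_cancel_left] at h1
      simp only [hg, hws, sub_self, map_zero, smul_zero, add_zero]
      exact h1.trans (mul_le_mul_of_nonneg_left (hmax hs) hL)
    obtain ⟨y, hy, hyn⟩ := hsm.exists_bounded hε0.le hηε hgdc hb ht₀
    rwa [hι (hy.trans (hd t₀ ht₀).symm)] at hyn
  have hd0 : ‖d t₀‖ ≤ 0 := by
    have := norm_nonneg (d t₀)
    have h1 : ε * L ≤ ε * L' := mul_le_mul_of_nonneg_left hLL' hε0.le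
    by_contra! hlt
    nlinarith
  refine ⟨δ, hδ0, hδρ, fun t ht => ?_⟩
  have hdt : d t = 0 := norm_le_zero_iff.1 ((hmax ht : ‖d t‖ ≤ ‖d t₀‖).trans hd0)
  simpa [hw, hdt] using hwnn t ht

end SemilinearACP

/-! ### Propagation of positivity along the existence interval. -/

theorem theoremC32
    -- `X` and `Y` are (real) Banach lattices
    {X : Type*} [NormedAddCommGroup X] [NormedSpace ℝ X] [CompleteSpace X]
    [Lattice X] [IsOrderedAddMonoid X] [IsOrderedModule ℝ X] [HasSolidNorm X]
    {Y : Type*} [NormedAddCommGroup Y] [NormedSpace ℝ Y] [CompleteSpace Y]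
    [Lattice Y] [IsOrderedAddMonoid Y] [IsOrderedModule ℝ Y] [HasSolidNorm Y]
    -- `Y` is continuously embedded in `X` as a sublattice
    (ι : Y →L[ℝ] X) (hι : Function.Injective ι)
    (hsup : ∀ y z : Y, ι (y ⊔ z) = ι y ⊔ ι z) (hinf : ∀ y z : Y, ι (y ⊓ z) = ι y ⊓ ι z)
    (T : EReal) (hT : 0 < T)
    -- (a)
    (G : X →ₗ.[ℝ] X) (S : ℝ → X →L[ℝ] X) (hG : Generates G S)
    (hSinv : LeavesInvariant ι S)
    (hScont : ∀ y : Y, ∃ g : ℝ → Y, ContinuousOn g (Ici 0) ∧ ∀ t : ℝ, 0 ≤ t → ι (g t) = S t (ι y))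
    -- (b)
    (hη : ∃ η : ℝ → ℝ, (∀ δ : ℝ, 0 < δ → 0 < η δ) ∧ Tendsto η (𝓝[>] 0) (𝓝 0) ∧
      ∀ s₀ s₁ : ℝ, 0 ≤ s₀ → s₀ < s₁ → ∀ φ : ℝ → X, ContinuousOn φ (Icc s₀ s₁) →
        ∃ y : Y, ι y = ∫ s in s₀..s₁, S (s₁ - s) (φ s) ∧
          ‖y‖ ≤ η (s₁ - s₀) * ⨆ s : Icc s₀ s₁, ‖φ s‖)
    -- (c)
    (F : ℝ → Y → X)
    (hFcont : ContinuousOn (fun p : ℝ × Y => F p.1 p.2) (timeInterval T ×ˢ univ))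
    (hFlip : LipschitzOnBounded T F)
    -- (d) the domain of `G` is a dense subspace of `Y`
    (hdom : (G.domain : Set X) ⊆ range ι) (hdense : Dense {y : Y | ι y ∈ G.domain})
    -- (e)
    (H : Y →ₗ[ℝ] X) (hHpos : ∀ y : Y, 0 ≤ y → 0 ≤ H y)
    (hGγ : ∀ γ : ℝ, 0 ≤ γ → ∃ Sγ : ℝ → X →L[ℝ] X, Generates (G - γ • operatorOn ι hι H) Sγ ∧
      IsPositiveSemigroup Sγ ∧ LeavesInvariant ι Sγ)
    -- (f)
    (hFpos : ∀ τ ∈ timeInterval T, ∀ r : ℝ, 0 < r → ∃ γ : ℝ, 0 ≤ γ ∧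
      ∀ v : Y, 0 ≤ v → ‖v‖ ≤ r → ∀ t ∈ Icc (0 : ℝ) τ, 0 ≤ F t v + γ • H v)
    -- the positive initial value and the maximal mild solution
    (u₀ : Y) (hu₀ : 0 ≤ u₀)
    (tmax : EReal) (u : ℝ → Y) (hu : IsMaximalMildSolution ι S T F u₀ tmax u) :
    ∀ t ∈ timeInterval tmax, 0 ≤ u t := by
  obtain ⟨-, htT, ⟨huc, hmild⟩, -⟩ := hu
  obtain ⟨η, hη0, hηlim, hηb⟩ := hη
  have hS := hG.1
  have hnn : ∀ y : Y, 0 ≤ y ↔ 0 ≤ ι y := fun y => by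
    rw [← sup_eq_left, ← sup_eq_left (a := ι y), ← map_zero ι, ← hsup, hι.eq_iff]
  have hH := continuous_of_map_nonneg H hHpos
  have hsm : IsSmoothing ι S η := by
    intro t ht φ hφ C hC
    obtain ⟨y, hy, hyn⟩ := hηb 0 t le_rfl ht φ hφ.continuousOn
    refine ⟨y, hy.trans (duhamel_eq ht.le).symm, hyn.trans ?_⟩
    rw [sub_zero]
    have : Nonempty (Icc (0 : ℝ) t) := ⟨⟨0, le_rfl, ht.le⟩⟩
    exact mul_le_mul_of_nonneg_left (ciSup_le fun s => hC s s.2) (hη0 t ht).le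
  intro b hb
  have hsub : Icc 0 b ⊆ timeInterval tmax := fun s hs =>
    ⟨hs.1, (EReal.coe_le_coe_iff.2 hs.2).trans_lt hb.2⟩
  have hsubT : Icc 0 b ⊆ timeInterval T := fun s hs => ⟨hs.1, (hsub hs).2.trans_le htT⟩
  have hbT : b ∈ timeInterval T := hsubT ⟨hb.1, le_rfl⟩
  obtain ⟨R, hR⟩ := isCompact_Icc.exists_bound_of_continuousOn (huc.mono hsub)
  have hR0 : 0 ≤ R := (norm_nonneg _).trans (hR 0 ⟨le_rfl, hb.1⟩)
  -- The extra `1` leaves room for corrections from the unit ball of `Y`.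
  obtain ⟨L, hL⟩ := hFlip b hbT (R + 1) (by linarith)
  obtain ⟨γ, hγ, hFγ⟩ := hFpos b hbT (R + 1) (by linarith)
  obtain ⟨S', hG', hpos, -⟩ := hGγ γ hγ
  -- Freezing time outside `[0, b]` makes `F` and `u` globally continuous without changing them on
  -- the interval.
  set p : ℝ → ℝ := fun s => projIcc 0 b hb.1 s with hp
  have hpc : Continuous p := continuous_subtype_val.comp continuous_projIcc
  have hpm : ∀ s, p s ∈ Icc 0 b := fun s => (projIcc 0 b hb.1 s).2
  have hpe : ∀ s ∈ Icc 0 b, p s = s := fun s hs => by simp only [hp, projIcc_of_mem hb.1 hs]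
  have hupc : Continuous fun s => u (p s) := huc.comp_continuous hpc fun s => hsub (hpm s)
  have hFpc : Continuous fun q : ℝ × Y => F (p q.1) q.2 :=
    hFcont.comp_continuous ((hpc.comp continuous_fst).prodMk continuous_snd)
      fun q => ⟨hsubT (hpm _), mem_univ _⟩
  have hφc : Continuous fun s => F (p s) (u (p s)) := hFpc.comp (continuous_id.prodMk hupc)
  have hmild' : ∀ t ∈ Icc 0 b, ι (u t) = S t (ι u₀) + duhamel S (fun s => F (p s) (u (p s))) t := by
    intro t ht
    rw [hmild t (hsub ht), ← duhamel_eq ht.1 (φ := fun s => F s (u s))]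
    congr 1
    exact duhamel_congr ht.1 fun s hs => by rw [hpe s ⟨hs.1, hs.2.trans ht.2⟩]
  have hu0 : u 0 = u₀ := by
    apply hι
    rw [hmild' 0 ⟨le_rfl, hb.1⟩, duhamel_zero, add_zero, hS.map_zero]
  have hclosed : IsClosed ({t : ℝ | 0 ≤ u t} ∩ Icc 0 b) := by
    rw [inter_comm]
    exact (huc.mono hsub).preimage_isClosed_of_isClosed isClosed_Icc isClosed_nonneg
  refine hclosed.Icc_subset_of_forall_exists_gt (by simpa [hu0] using hu₀) ?_ ⟨hb.1, le_rfl⟩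
  rintro a ⟨ha : 0 ≤ u a, ha0, hab⟩ c hc
  have hc' : a < c := hc
  have hpa : ∀ s ∈ Icc 0 (b - a), p (a + s) = a + s := fun s hs =>
    hpe _ ⟨by linarith [hs.1], by linarith [hs.2]⟩
  have hca : Continuous fun s : ℝ => a + s := continuous_const_add a
  -- By the cocycle identity, `u (a + ·)` is a mild solution of the time-shifted equation with
  -- initial value `u a ≥ 0`.
  obtain ⟨δ, hδ, hδb, hδu⟩ := exists_nonneg_of_mild hι hnn hG hηlim hsm hH hγ hG' hpos
    (F := fun s v => F (p (a + s)) v) (u := fun s => u (p (a + s))) (ρ := b - a) (R := R + 1)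
    (L := max L 0) (x := ι (u a))
    (hFpc.comp ((hca.comp continuous_fst).prodMk continuous_snd)) (hupc.comp hca)
    (sub_pos.2 hab) (fun s => by linarith [hR _ (hpm (a + s))]) (le_max_right _ _)
    (fun s _ v w hv hw => (hL v w hv hw _ (hpm _)).trans
      (mul_le_mul_of_nonneg_right (le_max_left _ _) (norm_nonneg _)))
    (fun s _ v hv hvR => hFγ v hv hvR _ (hpm _)) ((hnn _).1 ha) (fun t ht => by
      simp only [hpa t ht]
      rw [hmild' (a + t) ⟨by linarith [ht.1], by linarith [ht.2]⟩, hmild' a ⟨ha0, hab.le⟩,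
        duhamel_add_time hS hφc ha0 ht.1, map_add, add_comm a t, hS.map_add t a ht.1 ha0,
        add_assoc])
  set h := min δ (c - a) with hh
  have hh0 : 0 < h := lt_min hδ (sub_pos.2 hc')
  have hhδ : h ≤ δ := min_le_left _ _
  have hhc : h ≤ c - a := min_le_right _ _
  have := hδu h ⟨hh0.le, hhδ⟩
  simp only [hpa h ⟨hh0.le, hhδ.trans hδb⟩] at this
  exact ⟨a + h, this, by linarith, by linarith⟩
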